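/- A convex polytopal complex $P$ in $\mathbb{R}^d$ is a finite collection of convex polytopes (convex hulls of finite, possibly empty, sets of points) in $\mathbb{R}^d$ such that the empty polytope belongs to $P$, every face of a polytope of $P$ belongs to $P$, and the intersection of any two polytopes of $P$ is a (possibly empty) face of both; here the faces of a polytope are $\emptyset$ and the subsets on which some linear functional attains its maximum over the polytope. Let $P_0$ be the set of vertices of $P$ (the points $x$ with $\{x\}\in P$), let $P_{\max}$ be the set of polytopes of $P$ that are maximal with respect to inclusion, and let $R\subseteq P_0\times P_{\max}$ be the relation given by $x\,R\,p$ if and only if $x\in p$. Let $K_R$ be the Dowker complex of $R$, that is, the abstract simplicial complex whose simplices are the nonempty finite sets $\{x_1,\dots,x_n\}\subseteq P_0$ for which there is a $p\in P_{\max}$ with $x_i\,R\,p$ for all $i$. Lemma. For every $d\ge 0$ and every convex polytopal complex $P$ in $\mathbb{R}^d$, the underlying space $\bigcup_{p\in P}p$ (with the subspace topology of $\mathbb{R}^d$) is homotopy equivalent to the geometric realization $|K_R|$. -/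

import Mathlib

/-- A convex polytope in `ℝᵈ`: the convex hull of a finite (possibly empty) set of points. -/
def IsConvexPolytope {d : ℕ} (p : Set (EuclideanSpace ℝ (Fin d))) : Prop :=
  ∃ s : Finset (EuclideanSpace ℝ (Fin d)), p = convexHull ℝ (s : Set (EuclideanSpace ℝ (Fin d)))

/-- A convex polytopal complex in `ℝᵈ`. `IsExposed ℝ p q` says that `q` is a face of `p`, i.e. `q`
is empty or the set of points of `p` at which some linear functional attains its maximum over `p`.
Both `∅` and `p` itself are faces of `p`. -/
structure ConvexPolytopalComplex (d : ℕ) where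
  /-- The polytopes of the complex. -/
  cells : Set (Set (EuclideanSpace ℝ (Fin d)))
  finite_cells : cells.Finite
  isConvexPolytope_of_mem : ∀ p ∈ cells, IsConvexPolytope p
  empty_mem : ∅ ∈ cells
  face_mem : ∀ p ∈ cells, ∀ q, IsExposed ℝ p q → q ∈ cells
  inter_face : ∀ p ∈ cells, ∀ q ∈ cells, IsExposed ℝ p (p ∩ q) ∧ IsExposed ℝ q (p ∩ q)

namespace ConvexPolytopalComplex

variable {d : ℕ} (P : ConvexPolytopalComplex d)

/-- The underlying space: the union of all polytopes, with the subspace topology of `ℝᵈ`. -/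
def space : Set (EuclideanSpace ℝ (Fin d)) := ⋃₀ P.cells

/-- The set `P₀` of vertices: the points `x` such that `{x}` is a polytope of the complex. -/
def vertices : Set (EuclideanSpace ℝ (Fin d)) := {x | {x} ∈ P.cells}

/-- The set `P_max` of polytopes of the complex that are maximal for inclusion. -/
def maxCells : Set (Set (EuclideanSpace ℝ (Fin d))) := {p | Maximal (· ∈ P.cells) p}

/-- The incidence relation `R ⊆ P₀ × P_max`: `x R p` if and only if `x ∈ p`. -/
def incidence (x : P.vertices) (p : P.maxCells) : Prop :=
  (x : EuclideanSpace ℝ (Fin d)) ∈ (p : Set (EuclideanSpace ℝ (Fin d)))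

theorem finite_vertices : P.vertices.Finite :=
  P.finite_cells.preimage Set.singleton_injective.injOn

noncomputable instance : Fintype P.vertices := P.finite_vertices.fintype

end ConvexPolytopalComplex

/-- The Dowker complex `K_R` of a relation `R ⊆ X × Y`: its simplices are the nonempty finite
sets of elements of `X` that are all related to a common element of `Y`. -/
def dowkerComplex {X Y : Type*} (R : X → Y → Prop) : PreAbstractSimplicialComplex X where
  faces := {σ | σ.Nonempty ∧ ∃ y, ∀ x ∈ σ, R x y}
  isRelLowerSet_faces := by
    rintro σ ⟨hσ, y, hy⟩
    exact ⟨hσ, fun τ hτσ hτ => ⟨hτ, y, fun x hx => hy x (hτσ hx)⟩⟩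

/-- The geometric realization `|K|` of an abstract simplicial complex on a finite set `X`: the
points of the standard simplex on `X` (families of barycentric coordinates) that are supported on
a simplex of `K`, with the subspace topology of `ℝ^X`. -/
def geometricRealization {X : Type*} [Fintype X] (K : PreAbstractSimplicialComplex X) :
    Set (X → ℝ) :=
  {w | w ∈ stdSimplex ℝ X ∧ ∃ σ ∈ K.faces, ∀ x, w x ≠ 0 → x ∈ σ}

/-!
Write `|P|` for the underlying space and `|K|` for the realization of the Dowker complex. The map
`|K| → |P|` sends a family of barycentric coordinates `w` to the point `∑ x, w x • x`. In the other
direction, give each vertex `x` a continuous function `φ_x ≥ 0` on `ℝᵈ` that vanishes exactly on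
the nonempty cells that avoid `x`; on `|P|` it is positive precisely on the open star of `x`.
The open stars cover `|P|`: the cells containing `y` have a least element, the carrier of `y`,
and every nonempty cell contains a vertex, because a minimal nonempty cell has no proper nonempty
face and is therefore a point. Normalizing the `φ_x` gives a map `|P| → |K|`.

Both maps respect cells (`starCoord_mem`, `baryMap_mem`): a point of a cell `p` goes to coordinates
supported on the vertices in `p`, and such coordinates go to a point of `p`. Since `p` is convex,
and so is the set of coordinates supported on the vertices in `p`, both composites are homotopic
to the identity by straight-line homotopies.
-/

/-- Two maps into a subset of a topological vector space are homotopic as soon as the segments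
joining their values stay in the subset. -/
theorem ContinuousMap.homotopic_of_segment_subset {X E : Type*} [TopologicalSpace X]
    [AddCommGroup E] [Module ℝ E] [TopologicalSpace E] [IsTopologicalAddGroup E]
    [ContinuousSMul ℝ E] {s : Set E} (f g : C(X, s))
    (h : ∀ x, segment ℝ (f x : E) (g x : E) ⊆ s) : f.Homotopic g :=
  ⟨{ toFun := fun z => ⟨AffineMap.lineMap (f z.2 : E) (g z.2 : E) (z.1 : ℝ), h z.2 <| by
        rw [segment_eq_image_lineMap]
        exact ⟨_, z.1.2, rfl⟩⟩
     continuous_toFun := by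
        simp only [AffineMap.lineMap_apply_module]
        fun_prop
     map_zero_left := fun x => by simp
     map_one_left := fun x => by simp }⟩

namespace ConvexPolytopalComplex

open Metric

variable {d : ℕ} (P : ConvexPolytopalComplex d)

theorem isCompact_of_mem_cells {p : Set (EuclideanSpace ℝ (Fin d))} (hp : p ∈ P.cells) :
    IsCompact p := by
  obtain ⟨s, rfl⟩ := P.isConvexPolytope_of_mem p hp
  exact s.finite_toSet.isCompact_convexHull ℝ

theorem convex_of_mem_cells {p : Set (EuclideanSpace ℝ (Fin d))} (hp : p ∈ P.cells) :
    Convex ℝ p := by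
  obtain ⟨s, rfl⟩ := P.isConvexPolytope_of_mem p hp
  exact convex_convexHull ℝ _

theorem inter_mem_cells {p q : Set (EuclideanSpace ℝ (Fin d))} (hp : p ∈ P.cells)
    (hq : q ∈ P.cells) : p ∩ q ∈ P.cells :=
  P.face_mem p hp _ (P.inter_face p hp q hq).1

theorem exists_vertex_mem {p : Set (EuclideanSpace ℝ (Fin d))} (hp : p ∈ P.cells)
    (hne : p.Nonempty) : ∃ x ∈ P.vertices, x ∈ p := by
  have hfin : {q | q ∈ P.cells ∧ q.Nonempty}.Finite := P.finite_cells.subset fun q hq => hq.1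
  obtain ⟨m, hmp, hm⟩ := hfin.exists_le_minimal (a := p) ⟨hp, hne⟩
  obtain ⟨a, ha⟩ := hm.prop.2
  -- A functional separating two points of `m` would cut out a smaller nonempty face.
  have hsub : m = {a} := by
    refine Set.eq_singleton_iff_unique_mem.2 ⟨ha, fun b hb => ?_⟩
    by_contra hab
    obtain ⟨l, hl⟩ := geometric_hahn_banach_point_point hab
    obtain ⟨c, hc, hcmax⟩ := (P.isCompact_of_mem_cells hm.prop.1).exists_isMaxOn ⟨a, ha⟩
      l.continuous.continuousOn
    have hface : {x ∈ m | ∀ y ∈ m, l y ≤ l x} ∈ P.cells :=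
      P.face_mem m hm.prop.1 _ fun _ => ⟨l, rfl⟩
    have hle := hm.le_of_le ⟨hface, c, hc, fun y hy => hcmax hy⟩ (fun x hx => hx.1)
    exact absurd ((hle hb).2 a ha) (not_le.2 hl)
  exact ⟨a, show {a} ∈ P.cells from hsub ▸ hm.prop.1, hmp ha⟩

/-- Every point of the underlying space has a carrier: a least cell containing it. -/
theorem exists_carrier {y : EuclideanSpace ℝ (Fin d)} (hy : y ∈ P.space) :
    ∃ c ∈ P.cells, y ∈ c ∧ ∀ q ∈ P.cells, y ∈ q → c ⊆ q := by
  obtain ⟨p, hp, hyp⟩ := hy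
  have hfin : {q | q ∈ P.cells ∧ y ∈ q}.Finite := P.finite_cells.subset fun q hq => hq.1
  obtain ⟨m, -, hm⟩ := hfin.exists_le_minimal (a := p) ⟨hp, hyp⟩
  exact ⟨m, hm.prop.1, hm.prop.2, fun q hq hyq =>
    (hm.le_of_le ⟨P.inter_mem_cells hm.prop.1 hq, hm.prop.2, hyq⟩
      Set.inter_subset_left).trans Set.inter_subset_right⟩

open Classical in
/-- A nonnegative function on `ℝᵈ` that vanishes exactly on the nonempty cells avoiding `x`, as the
product of the distances to them. The empty cell is left out because `infDist y ∅ = 0`. -/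
noncomputable def starBump (x y : EuclideanSpace ℝ (Fin d)) : ℝ :=
  ∏ q ∈ P.finite_cells.toFinset with x ∉ q ∧ q.Nonempty, infDist y q

theorem continuous_starBump (x : EuclideanSpace ℝ (Fin d)) : Continuous (P.starBump x) :=
  continuous_finsetProd _ fun _ _ => continuous_infDist_pt _

theorem starBump_nonneg (x y : EuclideanSpace ℝ (Fin d)) : 0 ≤ P.starBump x y :=
  Finset.prod_nonneg fun _ _ => infDist_nonneg

theorem starBump_ne_zero_iff {x y : EuclideanSpace ℝ (Fin d)} :
    P.starBump x y ≠ 0 ↔ ∀ q ∈ P.cells, y ∈ q → x ∈ q := by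
  simp only [starBump, Finset.prod_ne_zero_iff, Finset.mem_filter, Set.Finite.mem_toFinset]
  constructor
  · intro h q hq hy
    by_contra hx
    exact h q ⟨hq, hx, y, hy⟩ (infDist_zero_of_mem hy)
  · rintro h q ⟨hq, hx, hne⟩ h0
    exact hx (h q hq (((P.isCompact_of_mem_cells hq).isClosed.mem_iff_infDist_zero hne).2 h0))

theorem sum_starBump_pos {y : EuclideanSpace ℝ (Fin d)} (hy : y ∈ P.space) :
    0 < ∑ x : P.vertices, P.starBump x y := by
  obtain ⟨c, hc, hyc, hmin⟩ := P.exists_carrier hy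
  obtain ⟨x, hx, hxc⟩ := P.exists_vertex_mem hc ⟨y, hyc⟩
  refine Finset.sum_pos' (fun x _ => P.starBump_nonneg x y) ⟨⟨x, hx⟩, Finset.mem_univ _, ?_⟩
  exact (P.starBump_nonneg x y).lt_of_ne'
    (P.starBump_ne_zero_iff.2 fun q hq hyq => hmin q hq hyq hxc)

/-- The barycentric coordinates of points supported on the vertices of `p`. -/
def coordsOn (p : Set (EuclideanSpace ℝ (Fin d))) : Set (P.vertices → ℝ) :=
  {w | w ∈ stdSimplex ℝ P.vertices ∧ ∀ x, w x ≠ 0 → (x : EuclideanSpace ℝ (Fin d)) ∈ p}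

theorem convex_coordsOn (p : Set (EuclideanSpace ℝ (Fin d))) : Convex ℝ (P.coordsOn p) := by
  rintro v ⟨hv, hvp⟩ w ⟨hw, hwp⟩ a b ha hb hab
  refine ⟨convex_stdSimplex ℝ _ hv hw ha hb hab, fun x hx => ?_⟩
  by_contra hxp
  have hv0 : v x = 0 := not_not.1 fun h => hxp (hvp x h)
  have hw0 : w x = 0 := not_not.1 fun h => hxp (hwp x h)
  simp [hv0, hw0] at hx

/-- A point of the realization has coordinates supported on some cell, maximal or not. -/
theorem mem_geometricRealization_iff {w : P.vertices → ℝ} :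
    w ∈ geometricRealization (dowkerComplex P.incidence) ↔ ∃ p ∈ P.cells, w ∈ P.coordsOn p := by
  constructor
  · rintro ⟨hw, σ, ⟨-, m, hm⟩, hσ⟩
    exact ⟨m, m.2.prop, hw, fun x hx => hm x (hσ x hx)⟩
  · rintro ⟨p, hp, hw, hwp⟩
    obtain ⟨m, hpm, hm⟩ := P.finite_cells.exists_le_maximal hp
    -- The coordinates sum to `1`, so their support is nonempty.
    have hsupp : ∃ x, w x ≠ 0 := by
      by_contra! h
      simpa [h] using hw.2
    obtain ⟨x, hx⟩ := hsupp
    exact ⟨hw, ({x | w x ≠ 0} : Set P.vertices).toFinite.toFinset,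
      ⟨⟨x, by simpa using hx⟩, ⟨m, hm⟩, fun z hz => hpm (hwp z (by simpa using hz))⟩,
      fun z hz => by simpa using hz⟩

/-- The normalized star bumps: coordinates on the vertices of the carrier of `y`. -/
noncomputable def starCoord (y : EuclideanSpace ℝ (Fin d)) (x : P.vertices) : ℝ :=
  P.starBump x y / ∑ z : P.vertices, P.starBump z y

theorem starCoord_mem {p : Set (EuclideanSpace ℝ (Fin d))} (hp : p ∈ P.cells)
    {y : EuclideanSpace ℝ (Fin d)} (hy : y ∈ p) : P.starCoord y ∈ P.coordsOn p := by
  have hpos := P.sum_starBump_pos ⟨p, hp, hy⟩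
  refine ⟨⟨fun x => div_nonneg (P.starBump_nonneg x y) hpos.le, ?_⟩, fun x hx => ?_⟩
  · simp only [starCoord]
    rw [← Finset.sum_div, div_self hpos.ne']
  · exact P.starBump_ne_zero_iff.1 (div_ne_zero_iff.1 hx).1 p hp hy

/-- The point with given barycentric coordinates with respect to the vertices. -/
noncomputable def baryMap (w : P.vertices → ℝ) : EuclideanSpace ℝ (Fin d) :=
  ∑ x : P.vertices, w x • (x : EuclideanSpace ℝ (Fin d))

theorem baryMap_mem {p : Set (EuclideanSpace ℝ (Fin d))} (hp : p ∈ P.cells)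
    {w : P.vertices → ℝ} (hw : w ∈ P.coordsOn p) : P.baryMap w ∈ p := by
  classical
  obtain ⟨⟨hw0, hw1⟩, hwp⟩ := hw
  have hsum : P.baryMap w = ∑ x with w x ≠ 0, w x • (x : EuclideanSpace ℝ (Fin d)) :=
    (Finset.sum_filter_of_ne fun x _ hx => (smul_ne_zero_iff.1 hx).1).symm
  rw [hsum]
  refine (P.convex_of_mem_cells hp).sum_mem (fun x _ => hw0 x) ?_ fun x hx =>
    hwp x (Finset.mem_filter.1 hx).2
  rw [Finset.sum_filter_ne_zero, hw1]

/-- The map from the underlying space to the realization given by the star coordinates. -/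
noncomputable def toRealization :
    C(P.space, geometricRealization (dowkerComplex P.incidence)) where
  toFun y := ⟨P.starCoord y, P.mem_geometricRealization_iff.2 <| by
    obtain ⟨p, hp, hy⟩ := y.2
    exact ⟨p, hp, P.starCoord_mem hp hy⟩⟩
  continuous_toFun := by
    refine Continuous.subtype_mk (continuous_pi fun x => ?_) _
    refine ((P.continuous_starBump x).comp continuous_subtype_val).div ?_ fun y =>
      (P.sum_starBump_pos y.2).ne'
    exact continuous_finsetSum _ fun z _ => (P.continuous_starBump z).comp continuous_subtype_val

/-- The map from the realization to the underlying space that is affine on each simplex. -/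
noncomputable def ofRealization :
    C(geometricRealization (dowkerComplex P.incidence), P.space) where
  toFun w := ⟨P.baryMap w, by
    obtain ⟨p, hp, hw⟩ := P.mem_geometricRealization_iff.1 w.2
    exact ⟨p, hp, P.baryMap_mem hp hw⟩⟩
  continuous_toFun := by
    refine Continuous.subtype_mk (continuous_finsetSum _ fun x _ => ?_) _
    exact ((continuous_apply x).comp continuous_subtype_val).smul continuous_const

end ConvexPolytopalComplex

theorem mainTheorem5 (d : ℕ) (P : ConvexPolytopalComplex d) :
    Nonempty (ContinuousMap.HomotopyEquiv P.space
      (geometricRealization (dowkerComplex P.incidence))) := by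
  refine ⟨⟨P.toRealization, P.ofRealization, ?_, ?_⟩⟩
  · refine ContinuousMap.homotopic_of_segment_subset _ _ fun y => ?_
    obtain ⟨p, hp, hy⟩ := y.2
    exact ((P.convex_of_mem_cells hp).segment_subset
      (P.baryMap_mem hp (P.starCoord_mem hp hy)) hy).trans fun z hz => ⟨p, hp, hz⟩
  · refine ContinuousMap.homotopic_of_segment_subset _ _ fun w => ?_
    obtain ⟨p, hp, hw⟩ := P.mem_geometricRealization_iff.1 w.2
    exact ((P.convex_coordsOn p).segment_subset
      (P.starCoord_mem hp (P.baryMap_mem hp hw)) hw).trans fun z hz =>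
        P.mem_geometricRealization_iff.2 ⟨p, hp, hz⟩
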